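/- For $p_0,p_1,p_2,p_3\in(0,1)$ let $$P(p_0,p_1,p_2,p_3)=\begin{pmatrix}1-p_0&p_0&0&0\\0&0&1-p_1&p_1\\1-p_2&p_2&0&0\\0&0&1-p_3&p_3\end{pmatrix},\qquad W=\begin{pmatrix}-1&1&0&0\\0&0&-1&1\\-1&1&0&0\\0&0&-1&1\end{pmatrix}$$ be the transition matrix of a history-dependent game on the states $0,1,2,3$ (loss-loss, loss-win, win-loss, win-win: the results of the two preceding games) and the matrix of payoffs $w(i,j)$. Let $\kappa>0$, $\lambda>0$ and $\lambda<1+\kappa$. Let game $A$ have transition matrix $P_A=P(\tfrac12,\tfrac12,\tfrac12,\tfrac12)$ and game $B$ transition matrix $P_B=P\big(\tfrac1{1+\kappa},\tfrac{\lambda}{1+\lambda},\tfrac{\lambda}{1+\lambda},1-\tfrac{\lambda}{1+\kappa}\big)$. For positive integers $r,s$, let $\pi$ be the unique stationary distribution of $P_A^rP_B^s$, and let $$\mu_{[r,s]}(0)=\frac1{r+s}\Big(\sum_{u=0}^{r-1}\sum_{i,j}(\pi P_A^u)_i(P_A)_{ij}w(i,j)+\sum_{v=0}^{s-1}\sum_{i,j}(\pi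 P_A^rP_B^v)_i(P_B)_{ij}w(i,j)\Big)$$ be the asymptotic mean profit per game played of the pattern $[r,s]$ ($r$ plays of game $A$ followed by $s$ plays of game $B$, repeated). Consider the following assertion about a pair $(\kappa,\lambda)$. For all positive integers $r$ and $s$: $\mu_{[r,s]}(0)>0$ if $\kappa<\lambda<1$ or $\kappa>\lambda>1$; $\mu_{[r,s]}(0)=0$ if $\kappa=\lambda$ or $\lambda=1$; and $\mu_{[r,s]}(0)<0$ if $\lambda<\min(\kappa,1)$ or $\lambda>\max(\kappa,1)$. Theorem. This assertion is true (a) if $\kappa=\lambda>0$; (b) if $\kappa>0$ and $\lambda=1$; (c) if $\kappa,\lambda\in K:=\{k/l: k,l=1,2,\dots,9\}$, $\lambda<1+\kappa$, $\kappa\ne\lambda$, $\lambda\ne1$ and $\kappa\lambda\ne1$; there are exactly $2123$ such pairs $(\kappa,\lambda)$. -/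

import Mathlib

open scoped Matrix

namespace Parrondo

/-- The one-step transition matrix of a history-dependent game. The states `0, 1, 2, 3`, read in
binary as `00, 01, 10, 11`, are the results (`0` a loss, `1` a win) of the two preceding games, the
more recent one last; in state `i` the player wins one unit with probability `p i` and loses one
unit with probability `1 - p i`. -/
def historyMatrix (p : Fin 4 → ℝ) : Matrix (Fin 4) (Fin 4) ℝ :=
  !![1 - p 0, p 0, 0, 0;
     0, 0, 1 - p 1, p 1;
     1 - p 2, p 2, 0, 0;
     0, 0, 1 - p 3, p 3]

/-- The payoff matrix: the profit made at a transition. -/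
def payoff : Matrix (Fin 4) (Fin 4) ℝ :=
  !![-1, 1, 0, 0;
     0, 0, -1, 1;
     -1, 1, 0, 0;
     0, 0, -1, 1]

/-- The transition matrix of game `A` (fair coin tossing; no bias parameter). -/
noncomputable def gameA : Matrix (Fin 4) (Fin 4) ℝ :=
  historyMatrix ![1 / 2, 1 / 2, 1 / 2, 1 / 2]

/-- The transition matrix of game `B` with parameters `κ` and `l` (no bias parameter). -/
noncomputable def gameB (κ l : ℝ) : Matrix (Fin 4) (Fin 4) ℝ :=
  historyMatrix ![1 / (1 + κ), l / (1 + l), l / (1 + l), 1 - l / (1 + κ)]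

/-- `π` is a stationary distribution (a probability row vector with `π P = π`) of `P`. -/
def IsStationary (P : Matrix (Fin 4) (Fin 4) ℝ) (π : Fin 4 → ℝ) : Prop :=
  (∀ i, 0 ≤ π i) ∧ ∑ i, π i = 1 ∧ π ᵥ* P = π

/-- The mean profit of one play with transition matrix `P` when the state before the play has
distribution `ν`. -/
def meanProfit (P : Matrix (Fin 4) (Fin 4) ℝ) (ν : Fin 4 → ℝ) : ℝ :=
  ∑ i, ∑ j, ν i * P i j * payoff i j

/-- The mean profit per game played of the pattern `[r, s]` (`r` plays of game `A`, then `s` plays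
of game `B`, repeated) when the state at the start of a period has distribution `π`. For the
stationary distribution `π` of `gameA ^ r * gameB κ l ^ s` this is the asymptotic mean profit per
game played of the pattern. -/
noncomputable def patternMean (r s : ℕ) (κ l : ℝ) (π : Fin 4 → ℝ) : ℝ :=
  (∑ u ∈ Finset.range r, meanProfit gameA (π ᵥ* gameA ^ u) +
    ∑ v ∈ Finset.range s, meanProfit (gameB κ l) (π ᵥ* (gameA ^ r * gameB κ l ^ v))) /
    ((r : ℝ) + (s : ℝ))

/-- The conjecture on the sign of the asymptotic mean profit per game of the patterns `[r, s]`, at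
the parameter values `κ` and `l`. -/
def SignConjecture (κ l : ℝ) : Prop :=
  ∀ r s : ℕ, 1 ≤ r → 1 ≤ s →
    (∃! π : Fin 4 → ℝ, IsStationary (gameA ^ r * gameB κ l ^ s) π) ∧
    ∀ π : Fin 4 → ℝ, IsStationary (gameA ^ r * gameB κ l ^ s) π →
      ((κ < l ∧ l < 1) ∨ (l < κ ∧ 1 < l) → 0 < patternMean r s κ l π) ∧
      (κ = l ∨ l = 1 → patternMean r s κ l π = 0) ∧
      (l < min κ 1 ∨ max κ 1 < l → patternMean r s κ l π < 0)

/-- The set of positive fractions with one-digit numerators and denominators. -/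
def oneDigitFractions : Set ℝ :=
  {x | ∃ a b : ℕ, 1 ≤ a ∧ a ≤ 9 ∧ 1 ≤ b ∧ b ≤ 9 ∧ x = (a : ℝ) / (b : ℝ)}

/-- The parameter pairs of the unfair case. -/
def unfairPairs : Set (ℝ × ℝ) :=
  {q | q.1 ∈ oneDigitFractions ∧ q.2 ∈ oneDigitFractions ∧
    q.2 < 1 + q.1 ∧ q.1 ≠ q.2 ∧ q.2 ≠ 1 ∧ q.1 * q.2 ≠ 1}

end Parrondo

/-!
Why the theorem is true. The sign statement holds for all `κ > 0` and `0 < l < 1 + κ`, and is proved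
in that generality (`signConjecture`); the three parameter families are special cases, and what is
left is a count of reduced fractions.

*Reduction to a scalar recurrence.* Put `p = 1 / (1 + κ)` and `q = l / (1 + κ)`. Then `p, q` range
over `(0, 1)` and game `B` has winning probabilities `p, q/(p+q), q/(p+q), 1 - q`, so that swapping
`p` with `q` amounts to exchanging wins with losses. Let `σ = p + q` and `M = pq / σ²`. Besides the
eigenvalue `1`, the matrix of game `B` has the roots of `x³ - t x² + b x + c` as eigenvalues, where
`t = 1 - σ`, `b = M (σ² - 1)`, `c = M (1 + σ)² - σ`. Let `h` be the impulse response of this cubic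
recurrence and `H` the sequence of its partial sums (`stepResponse`). Started from the uniform
distribution `u`, the `n`-th play of game `B` has mean profit `α h n` with
`α = (q - p)(1 - σ) / (2σ)` (`drift`); started from `d = (1, 1, -1, -1) / 4` it is
`-(t/2) h n + c h (n - 1)`. One play of game `A` forgets everything but the last result, so each
block of plays of `B` starts from `u + τ d` for a scalar `τ`, and `τ = 0` if `r ≥ 2`. The total mean
profit of a period is then `α H s` if `r ≥ 2`. If `r = 1`, stationarity determines `τ` and the total
is `α (H s + c (H (s-1)² - H s H (s-2)))` divided by a positive number; the factor of `α` is a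
Turán-type expression (`turan`). The sign of `α` is that of `(l - 1)(κ - l)`, so all depends on the
positivity of `H s` and of the Turán-type expression (`stepResponse_pos_and_turan_pos`).

*Positivity.* There are four regimes. If `σ ≤ 1` and `c ≤ 0`, the recurrence of `h` has nonnegative
coefficients. If `σ < 1` and `c > 0`, then `c ≤ -b t`, which gives the invariant
`c h n ≤ -b h (n + 1)`. If `σ > 1` and `c ≥ 0`, then `1 ≥ -t ≥ b ≥ c ≥ 0`, so the recurrence of
order four for `H` has nonnegative coefficients with sum `1`, whence `0 ≤ H ≤ 1`. If `σ > 1` and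
`c = -g < 0`, an interval is invariant for `H`, and the Turán expressions `G` satisfy the recurrence
of the second exterior power, `G (n+3) = b G (n+2) + g a G (n+1) + g² G n + R (n+2)` with `a = -t`,
which has nonnegative coefficients; the source `R` is affine in `H`, solves a recurrence of the same
kind as `H` and is kept nonnegative by an invariant interval as well (`turanSource_nonneg`).
-/

/-! ### The step response of a cubic recurrence and its Turán expressions -/

namespace Parrondo

/-- The partial sums `H` of the impulse response of the recurrence with characteristic polynomial
`x³ - t x² + b x + c`. The index is shifted by two, so that `stepResponse t b c (n + 2)` is `H n`
and the values at `0` and `1` are the zeros `H (-2)` and `H (-1)`. -/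
noncomputable def stepResponse (t b c : ℝ) : ℕ → ℝ
  | 0 => 0
  | 1 => 0
  | 2 => 0
  | n + 3 => 1 + t * stepResponse t b c (n + 2) - b * stepResponse t b c (n + 1)
      - c * stepResponse t b c n

section Response

variable {t b c : ℝ}

@[simp] lemma stepResponse_zero : stepResponse t b c 0 = 0 := by rw [stepResponse]

@[simp] lemma stepResponse_one : stepResponse t b c 1 = 0 := by rw [stepResponse]

@[simp] lemma stepResponse_two : stepResponse t b c 2 = 0 := by rw [stepResponse]

lemma stepResponse_add_three (n : ℕ) :
    stepResponse t b c (n + 3) = 1 + t * stepResponse t b c (n + 2)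
      - b * stepResponse t b c (n + 1) - c * stepResponse t b c n := by
  rw [stepResponse]

lemma three_term_induction {P : ℝ → ℝ → ℝ → Prop} {x : ℕ → ℝ} (h0 : P (x 0) (x 1) (x 2))
    (hs : ∀ n, P (x n) (x (n + 1)) (x (n + 2)) → P (x (n + 1)) (x (n + 2)) (x (n + 3))) (n : ℕ) :
    P (x n) (x (n + 1)) (x (n + 2)) := by
  induction n with
  | zero => exact h0
  | succ n ih => exact hs n ih

/-- The Turán-type expression `H n + c (H (n-1)² - H n H (n-2))`, in the shifted indexing of
`stepResponse`. -/
def turan (c : ℝ) (x : ℕ → ℝ) (n : ℕ) : ℝ := x (n + 2) + c * (x (n + 1) ^ 2 - x (n + 2) * x n)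

/-- The increments of the step response, that is the impulse response, solve the homogeneous
recurrence. -/
lemma impulse_rec (n : ℕ) :
    stepResponse t b c (n + 4) - stepResponse t b c (n + 3) =
      t * (stepResponse t b c (n + 3) - stepResponse t b c (n + 2))
      - b * (stepResponse t b c (n + 2) - stepResponse t b c (n + 1))
      - c * (stepResponse t b c (n + 1) - stepResponse t b c n) := by
  have h1 := stepResponse_add_three (t := t) (b := b) (c := c) (n + 1)
  have h2 := stepResponse_add_three (t := t) (b := b) (c := c) n
  simp only [add_assoc] at h1
  norm_num at h1
  linear_combination h1 - h2

/-- A property of three consecutive values of the impulse response that survives one step of the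
recurrence holds throughout; the starting values are `0, 0, 1`. -/
lemma impulse_induction {P : ℝ → ℝ → ℝ → Prop} (h0 : P 0 0 1)
    (hs : ∀ x y z, P x y z → P y z (t * z - b * y - c * x)) (n : ℕ) :
    P (stepResponse t b c (n + 1) - stepResponse t b c n)
      (stepResponse t b c (n + 2) - stepResponse t b c (n + 1))
      (stepResponse t b c (n + 3) - stepResponse t b c (n + 2)) := by
  induction n with
  | zero => simpa [stepResponse_add_three] using h0
  | succ n ih =>
    have := hs _ _ _ ih
    rwa [← impulse_rec] at this

lemma turan_eq (x : ℕ → ℝ) (n : ℕ) :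
    turan c x n = x (n + 2) * (1 + c * (x (n + 1) - x n))
      - c * (x (n + 2) - x (n + 1)) * x (n + 1) := by
  rw [turan]; ring

lemma stepResponse_three : stepResponse t b c 3 = 1 := by simp [stepResponse_add_three 0]

lemma nonneg_and_one_le_of_monotone (hm : Monotone (stepResponse t b c)) (n : ℕ) :
    0 ≤ stepResponse t b c n ∧ 1 ≤ stepResponse t b c (n + 3) := by
  have h0 := hm (Nat.zero_le n)
  have h3 := hm (show 3 ≤ n + 3 by lia)
  rw [stepResponse_zero] at h0
  rw [stepResponse_three] at h3
  exact ⟨h0, h3⟩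

/-- If the recurrence has nonnegative coefficients of sum at most `1`, the impulse response stays in
`[0, 1]`. -/
lemma pos_of_coeffs_nonpos (ht : 0 ≤ t) (hb : b ≤ 0) (hc : c ≤ 0) (hc1 : -1 < c)
    (hsum : t - b - c ≤ 1) (n : ℕ) :
    0 < stepResponse t b c (n + 3) ∧ 0 < turan c (stepResponse t b c) (n + 1) := by
  have h := impulse_induction (t := t) (b := b) (c := c)
    (P := fun x y z => (0 ≤ x ∧ x ≤ 1) ∧ (0 ≤ y ∧ y ≤ 1) ∧ 0 ≤ z ∧ z ≤ 1) (by norm_num) (by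
      rintro x y z ⟨⟨x0, x1⟩, ⟨y0, y1⟩, z0, z1⟩
      refine ⟨⟨y0, y1⟩, ⟨z0, z1⟩, ?_, ?_⟩
      · linarith [mul_nonneg ht z0, mul_nonneg (neg_nonneg.2 hb) y0,
          mul_nonneg (neg_nonneg.2 hc) x0]
      · linarith [mul_le_mul_of_nonneg_left z1 ht, mul_le_mul_of_nonneg_left y1 (neg_nonneg.2 hb),
          mul_le_mul_of_nonneg_left x1 (neg_nonneg.2 hc)])
  have hS := nonneg_and_one_le_of_monotone
    (monotone_nat_of_le_succ fun n => sub_nonneg.1 (h n).1.1)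
  obtain ⟨-, ⟨y0, y1⟩, z0, -⟩ := h n
  have h2 := (hS (n + 2)).1
  have h3 := (hS n).2
  refine ⟨by linarith, ?_⟩
  have e := turan_eq (c := c) (stepResponse t b c) (n + 1)
  simp only [add_assoc, Nat.reduceAdd] at e
  rw [e]
  have k1 : 0 < 1 + c * (stepResponse t b c (n + 2) - stepResponse t b c (n + 1)) := by
    nlinarith [hc1]
  have k2 := mul_pos (lt_of_lt_of_le one_pos h3) k1
  have k3 := mul_nonneg (mul_nonneg (neg_nonneg.2 hc) z0) h2
  linarith

/-- One coefficient of the recurrence is negative here, but `c ≤ -b t` makes the inequality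
`c x ≤ -b y` between consecutive values `x, y` of the impulse response an invariant. -/
lemma pos_of_last_coeff_pos (ht : 0 ≤ t) (ht1 : t ≤ 1) (hb : b < 0) (hb1 : -1 / 4 ≤ b) (hc : 0 < c)
    (hc1 : c ≤ 1 / 4) (hcb : c ≤ -b * t) (hsum : t - b - c ≤ 1) (n : ℕ) :
    0 < stepResponse t b c (n + 3) ∧ 0 < turan c (stepResponse t b c) (n + 1) := by
  -- The weighted sum in the last clause is `1` minus `1 - t + b + c` times the step response.
  have h := impulse_induction (t := t) (b := b) (c := c)
    (P := fun x y z => (0 ≤ x ∧ x ≤ 4 / 3) ∧ (0 ≤ y ∧ y ≤ 4 / 3) ∧ (0 ≤ z ∧ z ≤ 4 / 3) ∧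
      c * x ≤ -b * y ∧ c * y ≤ -b * z ∧ z + (1 - t) * y + (1 - t + b) * x ≤ 1) (by
      refine ⟨by norm_num, by norm_num, by norm_num, by simp, by linarith, by norm_num⟩) (by
      rintro x y z ⟨⟨x0, x1⟩, ⟨y0, y1⟩, ⟨z0, z1⟩, hxy, hyz, hv⟩
      have hw : t * z ≤ t * z - b * y - c * x := by linarith
      have hv' : t * z - b * y - c * x + (1 - t) * z + (1 - t + b) * y ≤ 1 := by nlinarith
      have htz := mul_nonneg ht z0
      refine ⟨⟨y0, y1⟩, ⟨z0, z1⟩, ⟨by linarith, ?_⟩, hyz, ?_, hv'⟩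
      · nlinarith
      · nlinarith)
  have hS := nonneg_and_one_le_of_monotone
    (monotone_nat_of_le_succ fun n => sub_nonneg.1 (h n).1.1)
  obtain ⟨-, ⟨y0, -⟩, ⟨z0, z1⟩, -⟩ := h n
  have h2 := (hS (n + 2)).1
  have h3 := (hS n).2
  refine ⟨by linarith, ?_⟩
  have e := turan_eq (c := c) (stepResponse t b c) (n + 1)
  simp only [add_assoc, Nat.reduceAdd] at e
  rw [e]
  have k1 : c * (stepResponse t b c (n + 3) - stepResponse t b c (n + 2)) ≤ 1 / 3 :=
    (mul_le_mul hc1 z1 z0 (by norm_num)).trans (by norm_num)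
  have k2 := mul_le_mul_of_nonneg_right k1 h2
  have k3 := mul_nonneg (mul_nonneg hc.le y0) (zero_le_one.trans h3)
  linarith

/-- Multiplying `1 - t X + b X² + c X³` by `1 - X` turns the recurrence of the step response into
one of order four in which every term is a convex combination of the preceding ones. -/
lemma pos_of_coeffs_antitone (ht : -1 < t) (hb : b ≤ -t) (hcb : c ≤ b) (hc : 0 ≤ c) (hc1 : c < 1)
    (n : ℕ) :
    0 < stepResponse t b c (n + 3) ∧ 0 < turan c (stepResponse t b c) (n + 1) := by
  set S := stepResponse t b c with hS
  have h : ∀ n, (0 ≤ S n ∧ S n ≤ 1) ∧ (0 ≤ S (n + 1) ∧ S (n + 1) ≤ 1) ∧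
      (0 ≤ S (n + 2) ∧ S (n + 2) ≤ 1) ∧ 0 < S (n + 3) ∧ S (n + 3) ≤ 1 := by
    intro n
    induction n with
    | zero => simp [hS, stepResponse_three]
    | succ n ih =>
      obtain ⟨⟨x0, x1⟩, ⟨y0, y1⟩, ⟨z0, z1⟩, w0, w1⟩ := ih
      have e : S (n + 4) - S (n + 3) = _ := impulse_rec n
      rw [← hS] at e
      have e' : S (n + 4) = (1 + t) * S (n + 3) + (-t - b) * S (n + 2) + (b - c) * S (n + 1)
          + c * S n := by linear_combination e
      have k3 : 0 < 1 + t := by linarith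
      have k2 : 0 ≤ -t - b := by linarith
      have k1 : 0 ≤ b - c := by linarith
      refine ⟨⟨y0, y1⟩, ⟨z0, z1⟩, ⟨w0.le, w1⟩, ?_, ?_⟩
      · change 0 < S (n + 4)
        rw [e']; positivity
      · change S (n + 4) ≤ 1
        rw [e']
        linarith [mul_le_mul_of_nonneg_left w1 k3.le, mul_le_mul_of_nonneg_left z1 k2,
          mul_le_mul_of_nonneg_left y1 k1, mul_le_mul_of_nonneg_left x1 hc]
  obtain ⟨-, ⟨y0, y1⟩, -, hp, -⟩ := h n
  refine ⟨hp, ?_⟩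
  have : turan c S (n + 1) = S (n + 3) * (1 - c * S (n + 1)) + c * S (n + 2) ^ 2 := by
    rw [turan]; ring
  rw [this]
  have h1 : 0 < 1 - c * S (n + 1) := sub_pos.2 ((mul_le_of_le_one_right hc y1).trans_lt hc1)
  positivity

end Response

section NegativeLastCoefficient

variable {a b g : ℝ}

/-- The inhomogeneous term of the recurrence `turan_rec`, as an affine function of the step
response. -/
def turanSource (a b g : ℝ) (x : ℕ → ℝ) (n : ℕ) : ℝ :=
  1 + g - (a + b + 2 * g) * x (n + 2) + (g - 2 * a * g - b) * x (n + 1) + g * (1 - b) * x n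

lemma turanSource_rec (n : ℕ) :
    turanSource a b g (stepResponse (-a) b (-g)) (n + 3) = 1 - b - a * g - g ^ 2
      - a * turanSource a b g (stepResponse (-a) b (-g)) (n + 2)
      - b * turanSource a b g (stepResponse (-a) b (-g)) (n + 1)
      + g * turanSource a b g (stepResponse (-a) b (-g)) n := by
  simp only [turanSource, add_assoc, Nat.reduceAdd]
  rw [stepResponse_add_three (n + 2), stepResponse_add_three (n + 1), stepResponse_add_three n]
  ring

/-- The Turán expressions are `2 × 2` minors of the step response, so their recurrence is that of
the second exterior power; its roots are the pairwise products of the roots of the cubic. -/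
lemma turan_rec (n : ℕ) :
    turan (-g) (stepResponse (-a) b (-g)) (n + 3) =
      b * turan (-g) (stepResponse (-a) b (-g)) (n + 2)
      + g * a * turan (-g) (stepResponse (-a) b (-g)) (n + 1)
      + g ^ 2 * turan (-g) (stepResponse (-a) b (-g)) n
      + turanSource a b g (stepResponse (-a) b (-g)) (n + 2) := by
  simp only [turanSource, turan, add_assoc, Nat.reduceAdd]
  rw [stepResponse_add_three (n + 2), stepResponse_add_three (n + 1), stepResponse_add_three n]
  ring

/-- Once three consecutive values of the source lie in `[0, k / (a + b)]`, its recurrence keeps it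
there. Here `k = 1 - b - a g - g²`. The value at index `0` may exceed the bound, so the invariant
starts at index `1`. -/
lemma turanSource_nonneg (ha : 0 < a) (hg : 0 ≤ g) (hb : b * (2 + a) = a * (1 + a - g))
    (hag : g * (1 + a) ^ 2 < 1 - a - a ^ 2) (n : ℕ) :
    0 ≤ turanSource a b g (stepResponse (-a) b (-g)) (n + 1) := by
  set R := turanSource a b g (stepResponse (-a) b (-g)) with hR
  set k := 1 - b - a * g - g ^ 2 with hk
  -- In terms of `a` and `s` both `b` and `g` are polynomials, and `hag` gives `hs1`.
  obtain ⟨s, hs⟩ : ∃ s, s = 1 - a - b - g := ⟨_, rfl⟩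
  have hbs : b = a ^ 2 + a * s / 2 := by rw [hs]; linear_combination hb / 2
  have hs1 : 2 * a * g ≤ s := by
    have : s * (2 + a) = 2 * (1 - a - a ^ 2 - g) := by rw [hs]; linear_combination -hb
    nlinarith
  have hs0 : 0 ≤ s := le_trans (by positivity) hs1
  have hb0 : 0 < b := by rw [hbs]; positivity
  have hg1 : g = 1 - a - b - s := by linarith
  have ha1 : a < 1 := by linarith
  have hks : k = s * (1 + a + g) + (a + g) * (a + b) := by rw [hk, hs]; ring
  have r0 : R 0 = 1 + g := by simp [hR, turanSource]
  have r1 : R 1 = s := by simp [hR, turanSource, stepResponse_three, hs]; ring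
  have r2 : R 2 = s + a + g - (1 - a) * (a + b) := by
    simp [hR, turanSource, stepResponse_three, stepResponse_add_three 1, hs]; ring
  have r3 : R 3 = k - a * R 2 - b * R 1 + g * R 0 := turanSource_rec 0
  rw [r0, r1] at r3
  have hab : 0 < a + b := by linarith
  have hag0 : 0 ≤ a + g := by linarith
  have hu : b + (1 - a) * (a + b) ≤ 1 := by
    have h1 : a * s ≤ a * (1 - a - b) := mul_le_mul_of_nonneg_left (by linarith) ha.le
    have h2 : a * a ^ 2 ≤ a * b := mul_le_mul_of_nonneg_left (by rw [hbs]; nlinarith) ha.le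
    -- What is left is `2 a - 2 a³ ≤ 1`; the maximum on the left is near `3 / 5`.
    have h3 := mul_nonneg (sq_nonneg (a - 3 / 5)) (show 0 ≤ a + 6 / 5 by linarith)
    linarith
  have q1 : 0 ≤ R 1 := by rw [r1]; exact hs0
  have q2 : 0 ≤ R 2 := by
    rw [r2]
    linarith
  have q3 : 0 ≤ R 3 := by
    have h2 : R 2 ≤ 1 := by rw [r2]; nlinarith
    rw [r3, hk]
    linarith [mul_le_mul_of_nonneg_left h2 ha.le, mul_nonneg (show 0 ≤ 1 - a by linarith) hg,
      mul_nonneg (show 0 ≤ 1 - b by linarith) hs0]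
  have p1 : (a + b) * R 1 ≤ k := by
    rw [r1, hks]
    linarith [mul_nonneg hag0 hab.le, mul_nonneg hs0 (show 0 ≤ 1 + g - b by linarith)]
  have p2 : (a + b) * R 2 ≤ k := by
    rw [r2, hks]
    linarith [mul_nonneg hs0 (show 0 ≤ 1 + g - b by linarith),
      mul_nonneg (show 0 ≤ 1 - a by linarith) (sq_nonneg (a + b))]
  have p3 : (a + b) * R 3 ≤ k := by
    have e : R 3 = a + g + (s * (1 + g - b) + g * (g + b)
        - a * (1 - (b + (1 - a) * (a + b)))) := by
      rw [r3, r2, hks, hg1]; ring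
    have h1 : 0 ≤ a * (1 - (b + (1 - a) * (a + b))) := mul_nonneg ha.le (by linarith)
    have h2 : (a + b) * (g * (g + b)) ≤ s * (1 - b) := by
      have hgb : g + b = 1 - a - s := by linarith
      have hbsq : b ≤ (a + s) ^ 2 := by rw [hbs]; nlinarith [mul_nonneg ha.le hs0, sq_nonneg s]
      have h4 : (1 + a + s / 2) * (g + b) ≤ 2 * (1 - b) := by
        have h5 := mul_nonneg hs0 (show 0 ≤ g + b by linarith)
        rw [hgb] at h5 ⊢
        linarith
      calc (a + b) * (g * (g + b)) = a * g * ((1 + a + s / 2) * (g + b)) := by rw [hbs]; ring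
        _ ≤ a * g * (2 * (1 - b)) := mul_le_mul_of_nonneg_left h4 (by positivity)
        _ = 2 * a * g * (1 - b) := by ring
        _ ≤ s * (1 - b) := mul_le_mul_of_nonneg_right hs1 (by linarith)
    have h3 : (a + b) * (1 + g - b) ≤ a + g + b := by
      linarith [mul_nonneg hab.le hb0.le, mul_nonneg (show 0 ≤ 1 - a - b by linarith) hg]
    have h4 := mul_nonneg hab.le h1
    have h5 := mul_le_mul_of_nonneg_left h3 hs0
    rw [e, hks]
    linarith
  have hk0 : 0 ≤ k := le_trans (mul_nonneg hab.le q1) p1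
  exact (three_term_induction (x := fun n => R (n + 1))
    (P := fun x y z => (0 ≤ x ∧ (a + b) * x ≤ k) ∧ (0 ≤ y ∧ (a + b) * y ≤ k) ∧
      (0 ≤ z ∧ (a + b) * z ≤ k)) ⟨⟨q1, p1⟩, ⟨q2, p2⟩, q3, p3⟩ (by
      rintro n ⟨⟨x0, x1⟩, ⟨y0, y1⟩, z0, z1⟩
      refine ⟨⟨y0, y1⟩, ⟨z0, z1⟩, ?_⟩
      have e : R (n + 4) = k - a * R (n + 3) - b * R (n + 2) + g * R (n + 1) :=
        turanSource_rec (n + 1)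
      change 0 ≤ R (n + 4) ∧ (a + b) * R (n + 4) ≤ k
      change 0 ≤ R (n + 1) at x0
      change 0 ≤ R (n + 2) at y0
      change 0 ≤ R (n + 3) at z0
      change (a + b) * R (n + 1) ≤ k at x1
      change (a + b) * R (n + 2) ≤ k at y1
      change (a + b) * R (n + 3) ≤ k at z1
      rw [e]
      constructor
      · refine nonneg_of_mul_nonneg_right (a := a + b) ?_ hab
        linarith [mul_le_mul_of_nonneg_left z1 ha.le, mul_le_mul_of_nonneg_left y1 hb0.le,
          mul_nonneg hab.le (mul_nonneg hg x0)]
      · linarith [mul_nonneg hab.le (mul_nonneg ha.le z0), mul_nonneg hab.le (mul_nonneg hb0.le y0),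
          mul_le_mul_of_nonneg_left x1 hg,
          mul_nonneg (show 0 ≤ 1 - a - b - g by linarith) hk0]) n).1.1

/-- The step response stays in `[0, 1 / (1 - g)]`, because `a + b < 1 - g`; the Turán expressions
are positive by their recurrence, all of whose coefficients are nonnegative here. -/
lemma pos_of_last_coeff_neg (ha : 0 < a) (hg : 0 ≤ g) (hb : b * (2 + a) = a * (1 + a - g))
    (hag : g * (1 + a) ^ 2 < 1 - a - a ^ 2) (n : ℕ) :
    0 < stepResponse (-a) b (-g) (n + 3) ∧ 0 < turan (-g) (stepResponse (-a) b (-g)) (n + 1) := by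
  have hg1 : g < 1 - a - a ^ 2 := by
    nlinarith [mul_nonneg hg (show 0 ≤ (1 + a) ^ 2 - 1 by nlinarith)]
  have hb0 : 0 < b := by
    have : 0 < b * (2 + a) := by rw [hb]; exact mul_pos ha (by linarith [sq_nonneg a])
    exact pos_of_mul_pos_left this (by linarith)
  have hab : a + b < 1 - g := by nlinarith
  set S := stepResponse (-a) b (-g) with hS
  have key : ∀ x y z : ℝ, (0 ≤ x ∧ (1 - g) * x ≤ 1) → (0 ≤ y ∧ (1 - g) * y ≤ 1) →
      (0 ≤ z ∧ (1 - g) * z ≤ 1) →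
      0 < 1 + -a * z - b * y - -g * x ∧ (1 - g) * (1 + -a * z - b * y - -g * x) ≤ 1 := by
    rintro x y z ⟨x0, x1⟩ ⟨y0, y1⟩ ⟨z0, z1⟩
    have k : 0 < 1 - g := by linarith
    refine ⟨?_, ?_⟩
    · refine pos_of_mul_pos_right (a := 1 - g) ?_ k.le
      nlinarith [mul_le_mul_of_nonneg_left z1 ha.le, mul_le_mul_of_nonneg_left y1 hb0.le,
        mul_nonneg k.le (mul_nonneg hg x0)]
    · nlinarith [mul_nonneg k.le (mul_nonneg ha.le z0), mul_nonneg k.le (mul_nonneg hb0.le y0),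
        mul_le_mul_of_nonneg_left x1 hg]
  have h := three_term_induction (x := S) (P := fun x y z => (0 ≤ x ∧ (1 - g) * x ≤ 1) ∧
    (0 ≤ y ∧ (1 - g) * y ≤ 1) ∧ (0 ≤ z ∧ (1 - g) * z ≤ 1)) (by simp [hS]) (by
      rintro n ⟨x, y, z⟩
      have := key _ _ _ x y z
      rw [hS, ← stepResponse_add_three] at this
      exact ⟨y, z, this.1.le, this.2⟩)
  have hpos : ∀ n, 0 < S (n + 3) := fun n => by
    rw [hS, stepResponse_add_three]
    exact (key _ _ _ (h n).1 (h n).2.1 (h n).2.2).1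
  refine ⟨hpos n, ?_⟩
  refine (three_term_induction (x := turan (-g) S) (P := fun x y z => 0 ≤ x ∧ 0 < y ∧ 0 < z)
    ?_ ?_ n).2.1
  · simp [turan, hS, stepResponse_three, stepResponse_add_three 1]
    linarith
  · rintro n ⟨x, y, z⟩
    refine ⟨y.le, z, ?_⟩
    rw [turan_rec]
    have := turanSource_nonneg ha hg hb hag (n + 1)
    positivity

end NegativeLastCoefficient

/-- Positivity for all admissible parameters. The last hypothesis says `(1 - p) (1 - q) > 0` when
`σ = p + q` and `M = p q / σ²`. -/
theorem stepResponse_pos_and_turan_pos {σ M : ℝ} (hσ : 0 < σ) (hσ2 : σ < 2) (hM : 0 < M)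
    (hM4 : M ≤ 1 / 4) (hσM : 0 < 1 - σ + M * σ ^ 2) (n : ℕ) :
    0 < stepResponse (1 - σ) (M * (σ ^ 2 - 1)) (M * (1 + σ) ^ 2 - σ) (n + 3) ∧
    0 < turan (M * (1 + σ) ^ 2 - σ)
      (stepResponse (1 - σ) (M * (σ ^ 2 - 1)) (M * (1 + σ) ^ 2 - σ)) (n + 1) := by
  have hc4 : M * (1 + σ) ^ 2 - σ ≤ (1 - σ) ^ 2 / 4 := by nlinarith
  have hc0 : -σ < M * (1 + σ) ^ 2 - σ := by
    linarith [mul_pos hM (show 0 < (1 + σ) ^ 2 by positivity)]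
  rcases le_or_gt σ 1 with h1 | h1
  · have hb : 0 ≤ M * (1 - σ ^ 2) := mul_nonneg hM.le (by nlinarith)
    have hsum : 1 - σ - M * (σ ^ 2 - 1) - (M * (1 + σ) ^ 2 - σ) ≤ 1 := by
      nlinarith [mul_pos hM hσ, mul_pos (mul_pos hM hσ) hσ]
    rcases le_or_gt (M * (1 + σ) ^ 2 - σ) 0 with hc | hc
    · exact pos_of_coeffs_nonpos (by linarith) (by linarith) hc (by linarith) hsum n
    · have hσ1 : σ < 1 := by
        refine lt_of_le_of_ne h1 ?_
        rintro rfl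
        linarith
      have hb0 : 0 < M * (1 - σ ^ 2) := mul_pos hM (by nlinarith)
      refine pos_of_last_coeff_pos (by linarith) (by linarith) (by linarith) (by nlinarith) hc
        (by nlinarith) ?_ hsum n
      have e : -(M * (σ ^ 2 - 1)) * (1 - σ) - (M * (1 + σ) ^ 2 - σ)
          = σ * (1 - M * (1 + σ) * (3 - σ)) := by ring
      have : M * ((1 + σ) * (3 - σ)) ≤ 1 / 4 * ((1 + σ) * (3 - σ)) :=
        mul_le_mul_of_nonneg_right hM4 (mul_nonneg (by linarith) (by linarith))
      have := mul_nonneg hσ.le (show 0 ≤ 1 - M * (1 + σ) * (3 - σ) by nlinarith [sq_nonneg (1 - σ)])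
      linarith
  · have hs : 0 < σ ^ 2 - 1 := by nlinarith
    rcases le_or_gt 0 (M * (1 + σ) ^ 2 - σ) with hc | hc
    · refine pos_of_coeffs_antitone (by linarith) ?_ ?_ hc (by nlinarith) n
      · nlinarith
      · refine le_of_mul_le_mul_right (a := σ + 1) ?_ (by linarith)
        have e1 := mul_nonneg (show 0 ≤ σ - 1 by linarith) hc
        have e2 := mul_le_mul_of_nonneg_right hc4 (show 0 ≤ σ + 1 by linarith)
        have e3 := mul_nonneg (show 0 ≤ σ - 1 by linarith)
          (show 0 ≤ 4 * σ - (σ ^ 2 - 1) by nlinarith)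
        linarith
    · have := pos_of_last_coeff_neg (a := σ - 1) (b := M * (σ ^ 2 - 1))
        (g := -(M * (1 + σ) ^ 2 - σ)) (by linarith) (by linarith) (by ring) ?_ n
      · simpa only [neg_sub, neg_neg] using this
      · nlinarith [mul_pos (show 0 < (1 + σ) ^ 2 by positivity) hσM]
/-! ### Plays of the two games in coordinates -/

/-- The last result as a function of the state, `-1` for a loss and `1` for a win. -/
def lastResult : Fin 4 → ℝ := ![-1, 1, -1, 1]

/-- The result before the last one as a function of the state. -/
def prevResult : Fin 4 → ℝ := ![-1, -1, 1, 1]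

/-- The product of the last two results as a function of the state. Together with `1`, `lastResult`
and `prevResult` it is a basis of the functions on the states. -/
def resultProduct : Fin 4 → ℝ := ![1, -1, -1, 1]

/-- The uniform distribution on the states. -/
noncomputable def uniformState : Fin 4 → ℝ := fun _ => 1 / 4

/-- The signed distribution by which the states after a play of game `A` deviate from uniformity, up
to a scalar. -/
noncomputable def tilt : Fin 4 → ℝ := ![1 / 4, 1 / 4, -1 / 4, -1 / 4]

/-- The profit of a play is the last result after it. -/
lemma meanProfit_historyMatrix (p x : Fin 4 → ℝ) :
    meanProfit (historyMatrix p) x = (x ᵥ* historyMatrix p) ⬝ᵥ lastResult := by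
  simp [meanProfit, historyMatrix, payoff, lastResult, Matrix.vecMul, dotProduct,
    Fin.sum_univ_four]
  ring

lemma vecMul_historyMatrix_dotProduct_lastResult (p x : Fin 4 → ℝ) :
    (x ᵥ* historyMatrix p) ⬝ᵥ lastResult = ∑ i, x i * (2 * p i - 1) := by
  simp [historyMatrix, lastResult, Matrix.vecMul, dotProduct, Fin.sum_univ_four]
  ring

lemma sum_vecMul_historyMatrix (p x : Fin 4 → ℝ) :
    ∑ i, (x ᵥ* historyMatrix p) i = ∑ i, x i := by
  simp [historyMatrix, Matrix.vecMul, dotProduct, Fin.sum_univ_four]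
  ring

/-- Game `A` remembers of the past only the last result. -/
lemma vecMul_gameA (x : Fin 4 → ℝ) :
    x ᵥ* gameA = (∑ i, x i) • uniformState + (-(x ⬝ᵥ lastResult)) • tilt := by
  ext i
  fin_cases i <;>
    simp [gameA, historyMatrix, uniformState, tilt, lastResult, Matrix.vecMul, dotProduct,
      Fin.sum_univ_four] <;> ring

lemma meanProfit_gameA (x : Fin 4 → ℝ) : meanProfit gameA x = 0 := by
  rw [gameA, meanProfit_historyMatrix, vecMul_historyMatrix_dotProduct_lastResult]
  simp [Fin.sum_univ_four]

lemma sum_uniformState : ∑ i, uniformState i = 1 := by simp [uniformState]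

lemma sum_tilt : ∑ i, tilt i = 0 := by
  simp [tilt, Fin.sum_univ_four]
  norm_num

lemma uniformState_vecMul_gameA : uniformState ᵥ* gameA = uniformState := by
  rw [vecMul_gameA, sum_uniformState]
  simp [uniformState, lastResult, dotProduct, Fin.sum_univ_four]

lemma tilt_vecMul_gameA : tilt ᵥ* gameA = 0 := by
  rw [vecMul_gameA, sum_tilt]
  simp [tilt, lastResult, dotProduct, Fin.sum_univ_four]

lemma uniformState_vecMul_gameA_pow (n : ℕ) : uniformState ᵥ* gameA ^ n = uniformState := by
  induction n with
  | zero => simp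
  | succ n ih => rw [pow_succ, ← Matrix.vecMul_vecMul, ih, uniformState_vecMul_gameA]

lemma vecMul_gameA_pow (x : Fin 4 → ℝ) (n : ℕ) :
    x ᵥ* gameA ^ (n + 2) = (∑ i, x i) • uniformState := by
  rw [add_comm, pow_add, ← Matrix.vecMul_vecMul, pow_two, ← Matrix.vecMul_vecMul, vecMul_gameA x,
    Matrix.add_vecMul, Matrix.smul_vecMul, Matrix.smul_vecMul, uniformState_vecMul_gameA,
    tilt_vecMul_gameA, smul_zero, add_zero, Matrix.smul_vecMul, uniformState_vecMul_gameA_pow]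

/-- Game `B` in the coordinates `p = 1 / (1 + κ)` and `q = l / (1 + κ)`. -/
noncomputable def fairGame (p q : ℝ) : Matrix (Fin 4) (Fin 4) ℝ :=
  historyMatrix ![p, q / (p + q), q / (p + q), 1 - q]

lemma gameB_eq_fairGame {κ l : ℝ} (hκ : 0 < κ) (hl : 0 < l) :
    gameB κ l = fairGame (1 / (1 + κ)) (l / (1 + κ)) := by
  have : l / (1 + κ) / (1 / (1 + κ) + l / (1 + κ)) = l / (1 + l) := by field_simp
  rw [gameB, fairGame, this]

section FairGame

variable {p q : ℝ}

/-- The step response of the cubic factor, other than `x - 1`, of the characteristic polynomial of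
`fairGame p q`; the index is shifted by two as in `stepResponse`. -/
noncomputable def response (p q : ℝ) : ℕ → ℝ :=
  stepResponse (1 - (p + q)) (p * q / (p + q) ^ 2 * ((p + q) ^ 2 - 1))
    (p * q / (p + q) ^ 2 * (1 + (p + q)) ^ 2 - (p + q))

/-- The mean profit of a play of `fairGame p q` in the uniform distribution. -/
noncomputable def drift (p q : ℝ) : ℝ := (q - p) * (1 - (p + q)) / (2 * (p + q))

/-- The action of a play of game `B` on distributions, in the coordinates given by the total mass,
the means of the last two results and the mean of their product. -/
lemma fairGame_step (h : p + q ≠ 0) (x : Fin 4 → ℝ) :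
    (∑ i, (x ᵥ* fairGame p q) i = ∑ i, x i) ∧
    (x ᵥ* fairGame p q) ⬝ᵥ prevResult = x ⬝ᵥ lastResult ∧
    (x ᵥ* fairGame p q) ⬝ᵥ lastResult = drift p q * ∑ i, x i
      + (1 - (p + q)) / 2 * (x ⬝ᵥ prevResult + x ⬝ᵥ lastResult)
      - (q - p) * (1 + (p + q)) / (2 * (p + q)) * x ⬝ᵥ resultProduct ∧
    (x ᵥ* fairGame p q) ⬝ᵥ resultProduct = drift p q * x ⬝ᵥ lastResult
      + (1 - (p + q)) / 2 * (x ⬝ᵥ resultProduct + ∑ i, x i)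
      - (q - p) * (1 + (p + q)) / (2 * (p + q)) * x ⬝ᵥ prevResult := by
  refine ⟨sum_vecMul_historyMatrix _ _, ?_, ?_, ?_⟩ <;>
  · simp [fairGame, historyMatrix, lastResult, prevResult, resultProduct, drift, Matrix.vecMul,
      dotProduct, Fin.sum_univ_four]
    try field_simp
    try ring

lemma response_rec (n : ℕ) :
    response p q (n + 4) - response p q (n + 3) =
      (1 - (p + q)) * (response p q (n + 3) - response p q (n + 2))
      - p * q / (p + q) ^ 2 * ((p + q) ^ 2 - 1) * (response p q (n + 2) - response p q (n + 1))
      - (p * q / (p + q) ^ 2 * (1 + (p + q)) ^ 2 - (p + q)) *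
        (response p q (n + 1) - response p q n) :=
  impulse_rec n

lemma uniformState_fairGame (h : 0 < p + q) (n : ℕ) :
    (∑ i, (uniformState ᵥ* fairGame p q ^ n) i = 1) ∧
    (uniformState ᵥ* fairGame p q ^ n) ⬝ᵥ prevResult =
      drift p q * (response p q (n + 1) - response p q n) ∧
    (uniformState ᵥ* fairGame p q ^ n) ⬝ᵥ lastResult =
      drift p q * (response p q (n + 2) - response p q (n + 1)) ∧
    (uniformState ᵥ* fairGame p q ^ n) ⬝ᵥ resultProduct =
      -((1 - (p + q)) / (1 + (p + q))) * (response p q (n + 3) - response p q (n + 2) - 1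
        - (1 - (p + q)) / 2 * (response p q (n + 2) - response p q n)) := by
  induction n with
  | zero =>
    simp [uniformState, lastResult, prevResult, resultProduct, response, stepResponse_three,
      dotProduct, Fin.sum_univ_four]
  | succ n ih =>
    obtain ⟨h1, h2, h3, h4⟩ := ih
    obtain ⟨k1, k2, k3, k4⟩ := fairGame_step h.ne' (uniformState ᵥ* fairGame p q ^ n)
    have h' : 1 + (p + q) ≠ 0 := by linarith
    rw [pow_succ, ← Matrix.vecMul_vecMul, k1, k2, k3, k4, h1, h2, h3, h4]
    have e := response_rec (p := p) (q := q) n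
    simp only [add_assoc, Nat.reduceAdd]
    refine ⟨trivial, trivial, ?_, ?_⟩
    · rw [drift]; have := h.ne'; field_simp; ring
    · rw [e, drift]
      have := h.ne'
      field_simp
      ring

/-- The formula for `prevResult` uses the recurrence to avoid the value of the impulse response
before index `-1`, which would not fit at `n = 0`. -/
lemma tilt_fairGame (h : 0 < p + q) (n : ℕ) :
    (∑ i, (tilt ᵥ* fairGame p q ^ n) i = 0) ∧
    (tilt ᵥ* fairGame p q ^ n) ⬝ᵥ lastResult =
      -((1 - (p + q)) / 2) * (response p q (n + 2) - response p q (n + 1))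
      + (p * q / (p + q) ^ 2 * (1 + (p + q)) ^ 2 - (p + q)) *
        (response p q (n + 1) - response p q n) ∧
    (tilt ᵥ* fairGame p q ^ n) ⬝ᵥ prevResult =
      -(response p q (n + 3) - response p q (n + 2))
      + (1 - (p + q)) * (response p q (n + 2) - response p q (n + 1))
      - (p * q / (p + q) ^ 2 * ((p + q) ^ 2 - 1) + (1 - (p + q)) / 2) *
        (response p q (n + 1) - response p q n) ∧
    (tilt ᵥ* fairGame p q ^ n) ⬝ᵥ resultProduct =
      (q - p) * (1 + (p + q)) / (2 * (p + q)) * (response p q (n + 2) - response p q (n + 1))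
      - drift p q * (response p q (n + 1) - response p q n) := by
  induction n with
  | zero =>
    simp [tilt, lastResult, prevResult, resultProduct, response, stepResponse_three,
      dotProduct, Fin.sum_univ_four]
    norm_num
  | succ n ih =>
    obtain ⟨h1, h2, h3, h4⟩ := ih
    obtain ⟨k1, k2, k3, k4⟩ := fairGame_step h.ne' (tilt ᵥ* fairGame p q ^ n)
    rw [pow_succ, ← Matrix.vecMul_vecMul, k1, k2, k3, k4, h1, h2, h3, h4]
    have e := response_rec (p := p) (q := q) n
    have := h.ne'
    simp only [add_assoc, Nat.reduceAdd]
    refine ⟨trivial, ?_, ?_, ?_⟩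
    · rw [drift]; field_simp; ring
    · rw [e]; field_simp; ring
    · rw [drift]; field_simp; ring

/-- The mean of the last result after `s` plays of game `B` started from `tilt`. -/
noncomputable def tiltResponse (p q : ℝ) (s : ℕ) : ℝ := (tilt ᵥ* fairGame p q ^ s) ⬝ᵥ lastResult

lemma sum_meanProfit (h : 0 < p + q) (t : ℝ) (s : ℕ) :
    ∑ v ∈ Finset.range s,
      meanProfit (fairGame p q) ((uniformState + t • tilt) ᵥ* fairGame p q ^ v) =
    drift p q * response p q (s + 2) + t * (-((1 - (p + q)) / 2) * response p q (s + 2)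
      + (p * q / (p + q) ^ 2 * (1 + (p + q)) ^ 2 - (p + q)) * response p q (s + 1)) := by
  induction s with
  | zero => simp [response]
  | succ s ih =>
    have e : meanProfit (fairGame p q) ((uniformState + t • tilt) ᵥ* fairGame p q ^ s) =
        ((uniformState + t • tilt) ᵥ* fairGame p q ^ (s + 1)) ⬝ᵥ lastResult := by
      rw [pow_succ, ← Matrix.vecMul_vecMul]
      exact meanProfit_historyMatrix _ _
    rw [Finset.sum_range_succ, ih, e, Matrix.add_vecMul, add_dotProduct, Matrix.smul_vecMul,
      smul_dotProduct, (uniformState_fairGame h _).2.2.1, (tilt_fairGame h _).2.1, smul_eq_mul]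
    simp only [add_assoc, Nat.reduceAdd]
    ring

lemma fairGame_pow_prob (hp : 0 < p) (hp1 : p < 1) (hq : 0 < q) (hq1 : q < 1) {x : Fin 4 → ℝ}
    (hx : ∀ i, 0 ≤ x i) (hx1 : ∑ i, x i = 1) (n : ℕ) :
    (∀ i, 0 ≤ (x ᵥ* fairGame p q ^ n) i) ∧ ∑ i, (x ᵥ* fairGame p q ^ n) i = 1 := by
  induction n with
  | zero => simpa using ⟨hx, hx1⟩
  | succ n ih =>
    rw [pow_succ, ← Matrix.vecMul_vecMul]
    refine ⟨?_, (sum_vecMul_historyMatrix _ _).trans ih.2⟩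
    have hb : 0 ≤ q / (p + q) := by positivity
    have hb1 : q / (p + q) ≤ 1 := by rw [div_le_one (by linarith)]; linarith
    have hP : ∀ i j, 0 ≤ fairGame p q i j := by
      intro i j
      fin_cases i <;> fin_cases j <;> simp [fairGame, historyMatrix] <;> linarith
    intro j
    rw [Matrix.vecMul, dotProduct]
    exact Finset.sum_nonneg fun i _ => mul_nonneg (ih.1 i) (hP i j)

lemma sum_mul_pos {x c : Fin 4 → ℝ} (hx : ∀ i, 0 ≤ x i) (hx1 : ∑ i, x i = 1) (hc : ∀ i, 0 < c i) :
    0 < ∑ i, x i * c i := by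
  obtain ⟨i, hi, hi0⟩ := Finset.exists_ne_zero_of_sum_ne_zero (hx1.trans_ne one_ne_zero)
  exact Finset.sum_pos' (fun i _ => mul_nonneg (hx i) (hc i).le)
    ⟨i, hi, mul_pos (lt_of_le_of_ne (hx i) hi0.symm) (hc i)⟩

lemma abs_lastResult_lt_one (hp : 0 < p) (hp1 : p < 1) (hq : 0 < q) (hq1 : q < 1) {x : Fin 4 → ℝ}
    (hx : ∀ i, 0 ≤ x i) (hx1 : ∑ i, x i = 1) {n : ℕ} (hn : 1 ≤ n) :
    |(x ᵥ* fairGame p q ^ n) ⬝ᵥ lastResult| < 1 := by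
  obtain ⟨n, rfl⟩ := Nat.exists_eq_add_of_le' hn
  obtain ⟨y0, y1⟩ := fairGame_pow_prob hp hp1 hq hq1 hx hx1 n
  rw [pow_succ, ← Matrix.vecMul_vecMul]
  set y := x ᵥ* fairGame p q ^ n
  set w : Fin 4 → ℝ := ![p, q / (p + q), q / (p + q), 1 - q] with hw
  have hb : 0 < q / (p + q) := by positivity
  have hb1 : q / (p + q) < 1 := by rw [div_lt_one (by linarith)]; linarith
  have e : (y ᵥ* fairGame p q) ⬝ᵥ lastResult = ∑ i, y i * (2 * w i - 1) :=
    vecMul_historyMatrix_dotProduct_lastResult _ _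
  have h1 := sum_mul_pos y0 y1 (c := w) (by intro i; fin_cases i <;> simp [hw] <;> linarith)
  have h2 := sum_mul_pos y0 y1 (c := 1 - w) (by intro i; fin_cases i <;> simp [hw] <;> linarith)
  rw [e, abs_lt]
  simp only [Fin.sum_univ_four, Pi.sub_apply, Pi.one_apply] at *
  constructor <;> linarith

/-- Both `uniformState + tilt` and `uniformState - tilt` are probability vectors, and after a play
of game `B` the last result has mean strictly between `-1` and `1`. -/
lemma tilt_bounds (hp : 0 < p) (hp1 : p < 1) (hq : 0 < q) (hq1 : q < 1) {s : ℕ} (hs : 1 ≤ s) :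
    |(uniformState ᵥ* fairGame p q ^ s) ⬝ᵥ lastResult| < 1 + tiltResponse p q s := by
  have h1 := abs_lastResult_lt_one hp hp1 hq hq1 (x := uniformState + (1 : ℝ) • tilt)
    (by intro i; fin_cases i <;> simp [uniformState, tilt] <;> norm_num)
    (by simp [Finset.sum_add_distrib, sum_tilt, sum_uniformState]) hs
  have h2 := abs_lastResult_lt_one hp hp1 hq hq1 (x := uniformState + (-1 : ℝ) • tilt)
    (by intro i; fin_cases i <;> simp [uniformState, tilt] <;> norm_num)
    (by simp [Finset.sum_add_distrib, sum_tilt, sum_uniformState]) hs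
  rw [Matrix.add_vecMul, add_dotProduct, Matrix.smul_vecMul, smul_dotProduct] at h1 h2
  change |_ + (1 : ℝ) * tiltResponse p q s| < 1 at h1
  change |_ + (-1 : ℝ) * tiltResponse p q s| < 1 at h2
  rw [abs_lt] at *
  constructor <;> linarith [h1.1, h1.2, h2.1, h2.2]

/-! ### The stationary distribution and the profit of a period -/

/-- The distribution at the start of the plays of game `B` is `uniformState + t • tilt`, where `t`
is `0` for `2 ≤ r` and is determined by stationarity for `r = 1`. The stationary distribution itself
is recovered from it by `s` plays of game `B`. -/
lemma exists_tilt_isStationary (hp : 0 < p) (hp1 : p < 1) (hq : 0 < q) (hq1 : q < 1)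
    {r s : ℕ} (hr : 1 ≤ r) (hs : 1 ≤ s) :
    ∃ t : ℝ, (t = 0 ∨ t * (1 + tiltResponse p q s) =
        -((uniformState ᵥ* fairGame p q ^ s) ⬝ᵥ lastResult)) ∧
      IsStationary (gameA ^ r * fairGame p q ^ s) ((uniformState + t • tilt) ᵥ* fairGame p q ^ s) ∧
      ∀ π, IsStationary (gameA ^ r * fairGame p q ^ s) π →
        π ᵥ* gameA ^ r = uniformState + t • tilt := by
  have hu : ∀ i, 0 ≤ uniformState i := fun i => by norm_num [uniformState]
  have hb := tilt_bounds hp hp1 hq hq1 hs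
  have hb0 : 0 < 1 + tiltResponse p q s := (abs_nonneg _).trans_lt hb
  obtain rfl | ⟨r, rfl⟩ : r = 1 ∨ ∃ k, r = k + 2 := by
    rcases Nat.lt_or_ge r 2 with h | h
    · left; lia
    · right; exact Nat.exists_eq_add_of_le' h
  · set m := (uniformState ᵥ* fairGame p q ^ s) ⬝ᵥ lastResult
    have hlin : ∀ t : ℝ, ((uniformState + t • tilt) ᵥ* fairGame p q ^ s) ⬝ᵥ lastResult =
        m + t * tiltResponse p q s := fun t => by
      rw [Matrix.add_vecMul, add_dotProduct, Matrix.smul_vecMul, smul_dotProduct]; rfl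
    have ht : -m / (1 + tiltResponse p q s) * (1 + tiltResponse p q s) = -m := by field_simp
    have ht1 : |-m / (1 + tiltResponse p q s)| ≤ 1 := by
      rw [abs_div, abs_neg, abs_of_pos hb0, div_le_one hb0]; exact hb.le
    set t := -m / (1 + tiltResponse p q s)
    have hν : ∑ i, (uniformState + t • tilt) i = 1 := by
      simp [Finset.sum_add_distrib, ← Finset.mul_sum, sum_tilt, sum_uniformState]
    have hν0 : ∀ i, 0 ≤ (uniformState + t • tilt) i := by
      rw [abs_le] at ht1
      intro i
      fin_cases i <;> simp [uniformState, tilt] <;> linarith [ht1.1, ht1.2]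
    obtain ⟨h0, h1⟩ := fairGame_pow_prob hp hp1 hq hq1 hν0 hν s
    refine ⟨t, Or.inr ht, ⟨h0, h1, ?_⟩, ?_⟩
    · rw [pow_one, ← Matrix.vecMul_vecMul, vecMul_gameA, h1, hlin, one_smul,
        show -(m + t * tiltResponse p q s) = t by linarith]
    · rintro π ⟨-, hπ1, hπ⟩
      rw [pow_one, ← Matrix.vecMul_vecMul, vecMul_gameA, hπ1, one_smul] at hπ
      rw [pow_one, vecMul_gameA, hπ1, one_smul]
      have e := congrArg (fun x => x ⬝ᵥ lastResult) hπ
      simp only [hlin] at e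
      have : -(π ⬝ᵥ lastResult) = t := by
        refine mul_right_cancel₀ hb0.ne' ?_
        rw [ht]; linarith
      rw [this]
  · obtain ⟨h0, h1⟩ := fairGame_pow_prob hp hp1 hq hq1 hu sum_uniformState s
    refine ⟨0, Or.inl rfl, ?_, ?_⟩
    · rw [zero_smul, add_zero]
      refine ⟨h0, h1, ?_⟩
      rw [← Matrix.vecMul_vecMul, vecMul_gameA_pow, h1, one_smul]
    · rintro π ⟨-, hπ1, -⟩
      rw [vecMul_gameA_pow, hπ1, one_smul, zero_smul, add_zero]

/-- The total mean profit of a period is a positive multiple of the drift. -/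
lemma profit_eq (hp : 0 < p) (hp1 : p < 1) (hq : 0 < q) (hq1 : q < 1) {s : ℕ} (hs : 1 ≤ s) {t : ℝ}
    (ht : t = 0 ∨ t * (1 + tiltResponse p q s) =
        -((uniformState ᵥ* fairGame p q ^ s) ⬝ᵥ lastResult)) :
    ∃ k : ℝ, 0 < k ∧ ∑ v ∈ Finset.range s,
      meanProfit (fairGame p q) ((uniformState + t • tilt) ᵥ* fairGame p q ^ v) =
        drift p q * k := by
  have hpq : 0 < p + q := by linarith
  obtain ⟨n, rfl⟩ := Nat.exists_eq_add_of_le' hs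
  obtain ⟨h1, h2⟩ := stepResponse_pos_and_turan_pos (σ := p + q) (M := p * q / (p + q) ^ 2) hpq
    (by linarith) (by positivity)
    (by rw [div_le_iff₀ (by positivity)]; linarith [sq_nonneg (p - q)])
    (by rw [div_mul_cancel₀ _ (by positivity)]; nlinarith) n
  rw [← response] at h1 h2
  rw [sum_meanProfit hpq]
  simp only [turan, add_assoc, Nat.reduceAdd] at h1 h2 ⊢
  rcases ht with rfl | ht
  · exact ⟨_, h1, by ring⟩
  · have hb := (abs_nonneg _).trans_lt (tilt_bounds hp hp1 hq hq1 hs)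
    have hbe := (tilt_fairGame hpq (n + 1)).2.1
    rw [← tiltResponse] at hbe
    refine ⟨_, div_pos h2 hb, ?_⟩
    rw [(uniformState_fairGame hpq _).2.2.1] at ht
    rw [mul_div_assoc', eq_div_iff hb.ne']
    simp only [add_assoc, Nat.reduceAdd] at hbe ht
    -- The terms with the factor `(1 - (p + q)) / 2` cancel, which leaves the Turán expression.
    rw [add_mul, mul_right_comm t, ht, hbe]
    ring

end FairGame

/-- The sign conjecture for all parameters for which the transition probabilities of game `B` lie
strictly between `0` and `1`. -/
theorem signConjecture {κ l : ℝ} (hκ : 0 < κ) (hl : 0 < l) (hlκ : l < 1 + κ) :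
    SignConjecture κ l := by
  intro r s hr hs
  set p := 1 / (1 + κ) with hp
  set q := l / (1 + κ) with hq
  have hp0 : 0 < p := by positivity
  have hq0 : 0 < q := by positivity
  have hp1 : p < 1 := by rw [hp, div_lt_one (by positivity)]; linarith
  have hq1 : q < 1 := by rw [hq, div_lt_one (by positivity)]; linarith
  have hB : gameB κ l = fairGame p q := gameB_eq_fairGame hκ hl
  rw [hB]
  obtain ⟨t, ht, hst, hπ⟩ := exists_tilt_isStationary hp0 hp1 hq0 hq1 hr hs
  refine ⟨⟨_, hst, fun π h => ?_⟩, fun π h => ?_⟩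
  · have := h.2.2
    rw [← Matrix.vecMul_vecMul, hπ π h] at this
    exact this.symm
  obtain ⟨k, hk, e⟩ := profit_eq hp0 hp1 hq0 hq1 hs ht
  have hμ : patternMean r s κ l π =
      (l - 1) * (κ - l) * (k / (2 * (1 + κ) * (1 + l) * (r + s))) := by
    have hrs : (0 : ℝ) < r + s := by
      have : (1 : ℝ) ≤ r := by exact_mod_cast hr
      positivity
    simp only [patternMean, hB, meanProfit_gameA, Finset.sum_const_zero, zero_add,
      ← Matrix.vecMul_vecMul, hπ π h]
    rw [e, drift, hp, hq]
    field_simp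
    ring
  have hpos : 0 < k / (2 * (1 + κ) * (1 + l) * (r + s)) := by
    have : (1 : ℝ) ≤ r := by exact_mod_cast hr
    positivity
  rw [hμ]
  refine ⟨?_, ?_, ?_⟩
  · rintro (⟨h1, h2⟩ | ⟨h1, h2⟩)
    · exact mul_pos (mul_pos_of_neg_of_neg (by linarith) (by linarith)) hpos
    · exact mul_pos (mul_pos (by linarith) (by linarith)) hpos
  · rintro (rfl | rfl) <;> simp
  · rintro (h1 | h1)
    · rw [lt_min_iff] at h1
      exact mul_neg_of_neg_of_pos (mul_neg_of_neg_of_pos (by linarith) (by linarith)) hpos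
    · rw [max_lt_iff] at h1
      exact mul_neg_of_neg_of_pos (mul_neg_of_pos_of_neg (by linarith) (by linarith)) hpos

/-! ### The count of the parameter pairs -/

/-- The reduced fractions with one-digit numerators and denominators, as pairs
`(numerator, denominator)`. -/
def reducedFractions : Finset (ℕ × ℕ) :=
  (Finset.Icc 1 9 ×ˢ Finset.Icc 1 9).filter fun x => x.1.gcd x.2 = 1

/-- The pairs of reduced fractions that represent `unfairPairs`. -/
def unfairCodes : Finset ((ℕ × ℕ) × (ℕ × ℕ)) :=
  (reducedFractions ×ˢ reducedFractions).filter fun z =>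
    z.2.1 * z.1.2 < z.2.2 * (z.1.2 + z.1.1) ∧ z.1.1 * z.2.2 ≠ z.2.1 * z.1.2 ∧
      z.2.1 ≠ z.2.2 ∧ z.1.1 * z.2.1 ≠ z.1.2 * z.2.2

lemma card_unfairCodes : unfairCodes.card = 2123 := by
  -- Counting row by row keeps the recursion of the kernel computation shallow.
  rw [unfairCodes, Finset.card_filter, Finset.sum_product]
  decide +kernel

/-- The value of a fraction given as a pair. -/
noncomputable def fracValue (x : ℕ × ℕ) : ℝ := (x.1 : ℝ) / x.2

lemma fracValue_injOn : Set.InjOn fracValue reducedFractions := by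
  rintro ⟨a, b⟩ hx ⟨c, d⟩ hy h
  simp only [reducedFractions, Finset.coe_filter, Finset.mem_product, Finset.mem_Icc,
    Set.mem_ofPred_eq] at hx hy
  have hb : (b : ℝ) ≠ 0 := by have := hx.1.2.1; positivity
  have hd : (d : ℝ) ≠ 0 := by have := hy.1.2.1; positivity
  simp only [fracValue] at h
  rw [div_eq_div_iff hb hd] at h
  have h' : a * d = c * b := by exact_mod_cast h
  have h1 : a = c := Nat.dvd_antisymm
    (Nat.Coprime.dvd_of_dvd_mul_right hx.2 (Dvd.intro _ h'))
    (Nat.Coprime.dvd_of_dvd_mul_right hy.2 (Dvd.intro _ h'.symm))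
  subst h1
  have := Nat.eq_of_mul_eq_mul_left (by lia) h'
  rw [this]

lemma oneDigitFractions_eq : oneDigitFractions = fracValue '' reducedFractions := by
  ext x
  constructor
  · rintro ⟨a, b, ha, ha9, hb, hb9, rfl⟩
    have hg : 0 < a.gcd b := Nat.gcd_pos_of_pos_left _ ha
    refine ⟨(a / a.gcd b, b / a.gcd b), ?_, ?_⟩
    · simp only [reducedFractions, Finset.coe_filter, Finset.mem_product, Finset.mem_Icc,
        Set.mem_ofPred_eq]
      exact ⟨⟨⟨Nat.div_pos (Nat.gcd_le_left _ ha) hg, (Nat.div_le_self _ _).trans ha9⟩,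
        Nat.div_pos (Nat.gcd_le_right _ hb) hg, (Nat.div_le_self _ _).trans hb9⟩,
        Nat.coprime_div_gcd_div_gcd hg⟩
    · have hg' : (a.gcd b : ℝ) ≠ 0 := by positivity
      rw [fracValue, Nat.cast_div (Nat.gcd_dvd_left a b) hg',
        Nat.cast_div (Nat.gcd_dvd_right a b) hg', div_div_div_cancel_right₀ hg']
  · rintro ⟨⟨a, b⟩, h, rfl⟩
    simp only [reducedFractions, Finset.coe_filter, Finset.mem_product, Finset.mem_Icc,
      Set.mem_ofPred_eq] at h
    exact ⟨a, b, h.1.1.1, h.1.1.2, h.1.2.1, h.1.2.2, rfl⟩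

lemma unfairPairs_eq : unfairPairs = Prod.map fracValue fracValue '' unfairCodes := by
  have key : ∀ x ∈ reducedFractions, ∀ y ∈ reducedFractions,
      ((fracValue y < 1 + fracValue x ↔ y.1 * x.2 < y.2 * (x.2 + x.1)) ∧
      (fracValue x = fracValue y ↔ x.1 * y.2 = y.1 * x.2) ∧
      (fracValue y = 1 ↔ y.1 = y.2) ∧ (fracValue x * fracValue y = 1 ↔ x.1 * y.1 = x.2 * y.2)) := by
    rintro ⟨a, b⟩ hx ⟨c, d⟩ hy
    simp only [reducedFractions, Finset.mem_filter, Finset.mem_product, Finset.mem_Icc] at hx hy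
    have hb : (0 : ℝ) < b := by have := hx.1.2.1; positivity
    have hd : (0 : ℝ) < d := by have := hy.1.2.1; positivity
    have e : 1 + (a : ℝ) / b = (b + a) / b := by field_simp
    simp only [fracValue]
    refine ⟨?_, ?_, ?_, ?_⟩
    · rw [e, div_lt_div_iff₀ hd hb, mul_comm ((b : ℝ) + a)]; exact_mod_cast Iff.rfl
    · rw [div_eq_div_iff hb.ne' hd.ne']; exact_mod_cast Iff.rfl
    · rw [div_eq_one_iff_eq hd.ne']; exact_mod_cast Iff.rfl
    · rw [div_mul_div_comm, div_eq_one_iff_eq (by positivity)]; exact_mod_cast Iff.rfl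
  ext ⟨κ, l⟩
  simp only [unfairPairs, oneDigitFractions_eq, unfairCodes, Set.mem_ofPred_eq, Set.mem_image,
    Finset.mem_coe, Finset.mem_filter, Finset.mem_product]
  constructor
  · rintro ⟨⟨x, hx, rfl⟩, ⟨y, hy, rfl⟩, h1, h2, h3, h4⟩
    obtain ⟨k1, k2, k3, k4⟩ := key x hx y hy
    exact ⟨(x, y), ⟨⟨hx, hy⟩, k1.1 h1, fun h => h2 (k2.2 h), fun h => h3 (k3.2 h),
      fun h => h4 (k4.2 h)⟩, rfl⟩
  · rintro ⟨⟨x, y⟩, ⟨⟨hx, hy⟩, h1, h2, h3, h4⟩, h⟩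
    obtain ⟨rfl, rfl⟩ := Prod.mk.inj h
    obtain ⟨k1, k2, k3, k4⟩ := key x hx y hy
    exact ⟨⟨x, hx, rfl⟩, ⟨y, hy, rfl⟩, k1.2 h1, fun h => h2 (k2.1 h), fun h => h3 (k3.1 h),
      fun h => h4 (k4.1 h)⟩

lemma fracValue_prodMap_injOn : Set.InjOn (Prod.map fracValue fracValue) unfairCodes := by
  refine (fracValue_injOn.prodMap fracValue_injOn).mono ?_
  rw [← Finset.coe_product, Finset.coe_subset]
  exact Finset.filter_subset _ _

lemma ncard_unfairPairs : unfairPairs.ncard = 2123 := by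
  rw [unfairPairs_eq, fracValue_prodMap_injOn.ncard_image, Set.ncard_coe_finset]
  exact card_unfairCodes

lemma pos_of_mem_oneDigitFractions {x : ℝ} (hx : x ∈ oneDigitFractions) : 0 < x := by
  obtain ⟨a, b, ha, -, hb, -, rfl⟩ := hx
  positivity

end Parrondo

theorem theorem10 :
    (∀ κ l : ℝ, 0 < κ → κ = l → Parrondo.SignConjecture κ l) ∧
    (∀ κ l : ℝ, 0 < κ → l = 1 → Parrondo.SignConjecture κ l) ∧
    (∀ κ l : ℝ, (κ, l) ∈ Parrondo.unfairPairs → Parrondo.SignConjecture κ l) ∧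
    Parrondo.unfairPairs.ncard = 2123 := by
  refine ⟨?_, ?_, ?_, Parrondo.ncard_unfairPairs⟩
  · rintro κ l hκ rfl
    exact Parrondo.signConjecture hκ hκ (by linarith)
  · rintro κ l hκ rfl
    exact Parrondo.signConjecture hκ one_pos (by linarith)
  · rintro κ l ⟨hκ, hl, hlt, -⟩
    exact Parrondo.signConjecture (Parrondo.pos_of_mem_oneDigitFractions hκ)
      (Parrondo.pos_of_mem_oneDigitFractions hl) hlt
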